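/- Let $n$ be a positive integer, let $\mathbb{H}$ be the real quaternions, and let $M_n(\mathbb{H})$ act on the left of the right $\mathbb{H}$-vector space $\mathbb{H}^n$ of column vectors. The spectrum of $A\in M_n(\mathbb{H})$ is the set of its right eigenvalues, i.e. of all $\lambda\in\mathbb{H}$ such that $Ax=x\lambda$ for some nonzero $x\in\mathbb{H}^n$. Let $\mathcal{S}\subseteq M_n(\mathbb{H})$ be a semigroup (a set of matrices closed under multiplication) that is irreducible, i.e. for every nonzero $x\in\mathbb{H}^n$ the orbit $\{Ax: A\in\mathcal{S}\}$ spans the right vector space $\mathbb{H}^n$. Suppose that the spectrum of every member of $\mathcal{S}$ is contained in $\mathbb{R}$. Then the real algebra ${\rm Alg}_{\mathbb{R}}(\mathcal{S})$ generated by $\mathcal{S}$ (equivalently, the real linear span of $\mathcal{S}$) is similar to $M_n(\mathbb{R})$: there is an invertible $P\in M_n(\mathbb{H})$ such that $${\rm Alg}_{\mathbb{R}}(\mathcal{S})=P^{-1}M_n(\mathbb{R})P=\{P^{-1}BP : B\in M_n(\mathbb{R})\}.$$ Moreover, the hypothesis on spectra is equivalent to a condition on minimal polynomials: for every $A\in M_n(\mathbb{H})$,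 the spectrum of $A$ is contained in $\mathbb{R}$ if and only if the minimal polynomial of $A$ over $\mathbb{R}$ splits into linear factors over $\mathbb{R}$. -/

import Mathlib

open scoped Quaternion Matrix

namespace QuatMatrix

/-- The ring `M_n(ℍ)` of `n × n` quaternionic matrices. -/
abbrev Mat (n : ℕ) : Type := Matrix (Fin n) (Fin n) ℍ[ℝ]

/-- A family `F` in `M_n(ℍ)` is irreducible if, for every nonzero column vector `x`, the orbit
of `x` under the multiplicative semigroup generated by `F` spans the right vector space `ℍ^n`.
The right scalar multiplication of `ℍ` on columns is the action of the opposite ring. -/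
def IsIrreducible {n : ℕ} (F : Set (Mat n)) : Prop :=
  ∀ x : Fin n → ℍ[ℝ], x ≠ 0 →
    Submodule.span ℍ[ℝ]ᵐᵒᵖ {y : Fin n → ℍ[ℝ] | ∃ A ∈ Subsemigroup.closure F, A *ᵥ x = y} = ⊤

/-- The quaternion `c` is a right eigenvalue of `A` if `A x = x c` for some nonzero column `x`. -/
def IsRightEigenvalue {n : ℕ} (A : Mat n) (c : ℍ[ℝ]) : Prop :=
  ∃ x : Fin n → ℍ[ℝ], x ≠ 0 ∧ A *ᵥ x = fun i => x i * c

/-- The spectrum of `A`: the set of all its right eigenvalues. -/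
def rightSpectrum {n : ℕ} (A : Mat n) : Set ℍ[ℝ] :=
  {c | IsRightEigenvalue A c}

/-- The spectrum of `A` consists of real numbers, `ℝ` being viewed as the center of `ℍ`. -/
def HasRealSpectrum {n : ℕ} (A : Mat n) : Prop :=
  rightSpectrum A ⊆ Set.range (fun r : ℝ => (r : ℍ[ℝ]))

/-- The real algebra generated by `F` (the smallest subring, possibly without the identity matrix,
that contains `F` and is closed under real scalars). -/
def realAlg {n : ℕ} (F : Set (Mat n)) : NonUnitalSubalgebra ℝ (Mat n) :=
  NonUnitalAlgebra.adjoin ℝ F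

/-- For a semigroup the generated real algebra is the real linear span. -/
theorem realAlg_eq_span {n : ℕ} (S : Subsemigroup (Mat n)) :
    (realAlg (S : Set (Mat n))).toSubmodule = Submodule.span ℝ (S : Set (Mat n)) := by
  rw [realAlg, NonUnitalAlgebra.adjoin_eq_span, Subsemigroup.closure_eq]

/-- `M_n(ℝ)` inside `M_n(ℍ)`: the matrices all of whose entries are real. -/
def realMatrices (n : ℕ) : Set (Mat n) :=
  Set.range (fun B : Matrix (Fin n) (Fin n) ℝ => B.map (fun r : ℝ => (r : ℍ[ℝ])))

/-- Sets of matrices `X` and `Y` are similar if `X = P⁻¹ Y P` for an invertible `P ∈ M_n(ℍ)`. -/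
def Similar {n : ℕ} (X Y : Set (Mat n)) : Prop :=
  ∃ P : (Mat n)ˣ, X = {A | ∃ B ∈ Y, A = (P⁻¹ : (Mat n)ˣ).val * B * P.val}

end QuatMatrix

/-! A right eigenvalue is a root of the real minimal polynomial, and a nonreal root produces a
nonreal right eigenvalue, so real spectrum means split minimal polynomial. In a finite-dimensional
normed algebra this condition is closed, so it passes from `ℝS` to its closure `T`. Take a nonzero
element of `T` of minimal rank. Irreducibility makes `T` act in a prime fashion, which yields a
non-nilpotent `F` of the same rank. A limit of normalized powers of `F ^ 2` is nonzero, hence by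
minimality injective on the range of `F`; so `F ^ 2` is a positive scalar there and a multiple of it
is an idempotent `E` (`IsSplitCone.exists_idempotent`). Nonzero elements of `T` in the corner of `E`
have positive scalar squares, hence commute, and primeness reduces the corner to `ℝE`
(`IsSplitCone.corner_eq_smul`). Finally, let `u` be a nonzero column of `E`. The orbit of `u` under
the real algebra contains a basis of columns, collected in `Q`. Since `E A E` is a real multiple of
`E`, the matrices `E A Q` are `u` times real rows; these rows fill `ℝ^n` and force `Q⁻¹ A Q` to be
real (`similar_of_isIrreducible`). -/

/-! ### Limits of powers. -/

section Analysis

open Filter Topology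

variable {B : Type*} [NormedRing B] [NormedAlgebra ℝ B]

/-- The powers of a unipotent block of size two are unbounded. -/
theorem unipotent_fixed_of_tendsto_pow {H L v w : B} {φ : ℕ → ℕ} (hφ : StrictMono φ)
    (hL : Tendsto (fun k => H ^ φ k) atTop (𝓝 L)) (hv : H * v = v + w) (hw : H * w = w) :
    w = 0 := by
  have hpow : ∀ m : ℕ, H ^ m * v = v + (m : ℝ) • w := by
    intro m
    induction m with
    | zero => simp
    | succ m ih =>
      rw [pow_succ', mul_assoc, ih, mul_add, hv, mul_smul_comm, hw]
      push_cast
      rw [add_smul, one_smul]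
      abel
  by_contra hw0
  have h1 : Tendsto (fun k => (φ k : ℝ) • w) atTop (𝓝 (L * v - v)) := by
    have := (hL.mul_const v).sub_const v
    refine this.congr fun k => ?_
    rw [hpow, add_sub_cancel_left]
  have h2 := h1.norm
  have h3 : Tendsto (fun k => ‖(φ k : ℝ) • w‖) atTop atTop := by
    simp only [norm_smul, Real.norm_natCast]
    exact (tendsto_natCast_atTop_atTop.comp hφ.tendsto_atTop).atTop_mul_const
      (norm_pos_iff.mpr hw0)
  exact not_tendsto_nhds_of_tendsto_atTop h3 _ h2

/-- If a subsequence of the powers converges to something that does not kill an eigenvector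
with nonnegative eigenvalue, then that eigenvalue is one. -/
theorem eigenvalue_eq_one_of_tendsto_pow {H L v : B} {φ : ℕ → ℕ} (hφ : StrictMono φ)
    (hL : Tendsto (fun k => H ^ φ k) atTop (𝓝 L)) {μ : ℝ} (hμ : 0 ≤ μ)
    (hv : H * v = μ • v) (hLv : L * v ≠ 0) : μ = 1 := by
  have hpow : ∀ m : ℕ, H ^ m * v = μ ^ m • v := by
    intro m
    induction m with
    | zero => simp
    | succ m ih => rw [pow_succ', mul_assoc, ih, mul_smul_comm, hv, smul_smul, pow_succ]
  have hv0 : v ≠ 0 := by rintro rfl; simp at hLv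
  have h1 : Tendsto (fun k => μ ^ φ k • v) atTop (𝓝 (L * v)) :=
    (hL.mul_const v).congr fun k => hpow _
  rcases lt_trichotomy μ 1 with h | h | h
  · exfalso
    have h2 := ((tendsto_pow_atTop_nhds_zero_of_lt_one hμ h).comp hφ.tendsto_atTop).smul_const v
    rw [zero_smul] at h2
    exact hLv (tendsto_nhds_unique h1 h2)
  · exact h
  · exfalso
    have h3 : Tendsto (fun k => ‖μ ^ φ k • v‖) atTop atTop := by
      simp only [norm_smul, norm_pow, Real.norm_of_nonneg hμ]
      exact ((tendsto_pow_atTop_atTop_of_one_lt h).comp hφ.tendsto_atTop).atTop_mul_const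
        (norm_pos_iff.mpr hv0)
    exact not_tendsto_nhds_of_tendsto_atTop h3 _ h1.norm

end Analysis

/-! ### Elements of minimal rank. -/

section MinimalRank

variable {B : Type*} [NormedRing B] [NormedAlgebra ℝ B]

/-- The right ideal `A B`, as a real subspace. -/
noncomputable def rightIdeal (A : B) : Submodule ℝ B := LinearMap.range (LinearMap.mulLeft ℝ A)

theorem mem_rightIdeal {A x : B} : x ∈ rightIdeal A ↔ ∃ y, A * y = x := by
  simp [rightIdeal]

theorem self_mem_rightIdeal (A : B) : A ∈ rightIdeal A := mem_rightIdeal.mpr ⟨1, mul_one A⟩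

theorem mul_mem_rightIdeal (A y : B) : A * y ∈ rightIdeal A := mem_rightIdeal.mpr ⟨y, rfl⟩

theorem rightIdeal_le {A A' : B} (h : A' ∈ rightIdeal A) : rightIdeal A' ≤ rightIdeal A := by
  obtain ⟨y, rfl⟩ := mem_rightIdeal.mp h
  intro x hx
  obtain ⟨z, rfl⟩ := mem_rightIdeal.mp hx
  rw [mul_assoc]
  exact mul_mem_rightIdeal _ _

/-- A nonzero element of `T` generating a right ideal of least dimension. -/
structure IsMinimalRank (T : Set B) (A : B) : Prop where
  mem : A ∈ T
  ne_zero : A ≠ 0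
  le : ∀ A' ∈ T, A' ≠ 0 → Module.finrank ℝ (rightIdeal A) ≤ Module.finrank ℝ (rightIdeal A')

variable {T : Set B}

theorem exists_isMinimalRank (h : ∃ A ∈ T, A ≠ 0) : ∃ A, IsMinimalRank T A := by
  obtain ⟨A₀, hA₀, hne⟩ := h
  obtain ⟨A, ⟨hA, hA'⟩, hle⟩ := exists_minimalFor_of_wellFoundedLT (fun A => A ∈ T ∧ A ≠ 0)
    (fun A => Module.finrank ℝ (rightIdeal A)) ⟨A₀, hA₀, hne⟩
  refine ⟨A, hA, hA', fun A' h1 h2 => ?_⟩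
  rcases le_total (Module.finrank ℝ (rightIdeal A)) (Module.finrank ℝ (rightIdeal A')) with h | h
  · exact h
  · exact hle ⟨h1, h2⟩ h

theorem rightIdeal_map_mulLeft (L A : B) :
    (rightIdeal A).map (LinearMap.mulLeft ℝ L) = rightIdeal (L * A) := by
  rw [rightIdeal, rightIdeal, ← LinearMap.range_comp, LinearMap.mulLeft_mul]

variable [FiniteDimensional ℝ B]

theorem IsMinimalRank.rightIdeal_eq {A A' : B} (hA : IsMinimalRank T A) (hT : A' ∈ T)
    (h0 : A' ≠ 0) (h : A' ∈ rightIdeal A) : rightIdeal A' = rightIdeal A :=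
  Submodule.eq_of_le_of_finrank_le (rightIdeal_le h) (hA.le A' hT h0)

theorem IsMinimalRank.of_mem {A A' : B} (hA : IsMinimalRank T A) (hT : A' ∈ T)
    (h0 : A' ≠ 0) (h : A' ∈ rightIdeal A) : IsMinimalRank T A' := by
  refine ⟨hT, h0, ?_⟩
  rw [hA.rightIdeal_eq hT h0 h]
  exact hA.le

/-- Left multiplication mapping a finite-dimensional space onto itself is injective on it. -/
theorem eq_zero_of_map_mulLeft_eq {L v : B} {R : Submodule ℝ B}
    (h : R.map (LinearMap.mulLeft ℝ L) = R) (hv : v ∈ R) (hLv : L * v = 0) : v = 0 := by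
  have hR : ∀ x ∈ R, LinearMap.mulLeft ℝ L x ∈ R := fun x hx => by
    rw [← h]; exact Submodule.mem_map_of_mem hx
  have hsurj : Function.Surjective ((LinearMap.mulLeft ℝ L).restrict hR) := by
    rintro ⟨y, hy⟩
    rw [← h] at hy
    obtain ⟨x, hx, rfl⟩ := hy
    exact ⟨⟨x, hx⟩, rfl⟩
  have hinj := LinearMap.injective_iff_surjective.mpr hsurj
  have : (⟨v, hv⟩ : R) = 0 := hinj (by ext; simpa using hLv)
  simpa using this

end MinimalRank

/-! ### Eigenvectors from split annihilating polynomials. -/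

section Splitting

variable {B : Type*} [Ring B] [Algebra ℝ B]

/-- A product of linear factors that kills a nonzero vector yields an eigenvector. -/
theorem exists_eigenvector_of_prod (F : B) (R : Submodule ℝ B)
    (hR : ∀ x ∈ R, F * x ∈ R) (s : Multiset ℝ) {v : B} (hv : v ∈ R) (hv0 : v ≠ 0)
    (h : Polynomial.aeval F (s.map fun a => Polynomial.X - Polynomial.C a).prod * v = 0) :
    ∃ a : ℝ, ∃ w ∈ R, w ≠ 0 ∧ F * w = a • w := by
  induction s using Multiset.induction_on generalizing v with
  | empty => simp at h; exact absurd h hv0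
  | cons a s ih =>
    by_cases hz : F * v - a • v = 0
    · exact ⟨a, v, hv, hv0, sub_eq_zero.mp hz⟩
    · refine ih (R.sub_mem (hR v hv) (R.smul_mem a hv)) hz ?_
      rw [Multiset.map_cons, Multiset.prod_cons, mul_comm, map_mul, mul_assoc] at h
      rwa [map_sub, Polynomial.aeval_X, Polynomial.aeval_C, sub_mul, ← Algebra.smul_def] at h

/-- If all eigenvalues on an invariant subspace have the same square `c` and `F ^ 2 - c` has
no nontrivial Jordan blocks, then `F ^ 2 = c` there. -/
theorem sq_mul_eq_smul_of_prod (F : B) (R : Submodule ℝ B) (hR : ∀ x ∈ R, F * x ∈ R) (c : ℝ)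
    (heig : ∀ a : ℝ, ∀ w ∈ R, w ≠ 0 → F * w = a • w → a ^ 2 = c)
    (hss : ∀ v ∈ R, ∀ w ∈ R, F ^ 2 * v = c • v + w → F ^ 2 * w = c • w → w = 0)
    (s : Multiset ℝ) {v : B} (hv : v ∈ R)
    (h : Polynomial.aeval F (s.map fun a => Polynomial.X - Polynomial.C a).prod * v = 0) :
    F ^ 2 * v = c • v := by
  induction s using Multiset.induction_on generalizing v with
  | empty => simp at h; simp [h]
  | cons a s ih =>
    have h1 : F ^ 2 * (F * v - a • v) = c • (F * v - a • v) := by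
      refine ih (R.sub_mem (hR v hv) (R.smul_mem a hv)) ?_
      rw [Multiset.map_cons, Multiset.prod_cons, mul_comm, map_mul, mul_assoc] at h
      rwa [map_sub, Polynomial.aeval_X, Polynomial.aeval_C, sub_mul, ← Algebra.smul_def] at h
    have hu : F ^ 2 * v - c • v ∈ R := by
      refine R.sub_mem ?_ (R.smul_mem c hv)
      rw [pow_two, mul_assoc]
      exact hR _ (hR _ hv)
    -- The inductive hypothesis says that `F ^ 2 - c` kills `(F - a) v`; commuting the factors makes
    -- `(F ^ 2 - c) v` an `a`-eigenvector, to which `heig` and `hss` apply.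
    have h2 : F * (F ^ 2 * v - c • v) = a • (F ^ 2 * v - c • v) := by
      rw [mul_sub, mul_smul_comm, smul_sub] at h1
      have h3 : F * (F ^ 2 * v) = F ^ 2 * (F * v) := by
        rw [← mul_assoc, ← mul_assoc, ← pow_succ, ← pow_succ']
      rw [mul_sub, h3, mul_smul_comm, smul_sub, smul_comm a c]
      exact sub_eq_sub_iff_sub_eq_sub.mp h1
    by_contra hne
    have hu0 : F ^ 2 * v - c • v ≠ 0 := fun h => hne (sub_eq_zero.mp h)
    have hac := heig a _ hu hu0 h2
    refine hu0 (hss v hv _ hu (by abel) ?_)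
    rw [pow_two F, mul_assoc, ← pow_two F, h2, mul_smul_comm, h2, smul_smul, ← pow_two, hac]

end Splitting

/-! ### Closedness of the splitting condition. -/

section SplitClosed

open Polynomial

/-- A real monic polynomial splits iff it is bounded below by powers of the imaginary part. -/
theorem splits_iff_im_pow_le {p : ℝ[X]} (hp : p.Monic) :
    p.Splits ↔ ∀ z : ℂ, |z.im| ^ p.natDegree ≤ ‖aeval z p‖ := by
  constructor
  · intro h z
    have h1 : p = (p.roots.map fun a => X - C a).prod := h.eq_prod_roots_of_monic hp
    rw [h.natDegree_eq_card_roots]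
    conv_rhs => rw [h1]
    generalize p.roots = s
    induction s using Multiset.induction_on with
    | empty => simp
    | cons a s ih =>
      rw [Multiset.map_cons, Multiset.prod_cons, Multiset.card_cons, map_mul, norm_mul, pow_succ']
      refine mul_le_mul ?_ ih (by positivity) (norm_nonneg _)
      have := Complex.abs_im_le_norm (z - (a : ℂ))
      simpa using this
  · intro h
    have hs : (p.map (algebraMap ℝ ℂ)).Splits := IsAlgClosed.splits _
    refine hs.of_splits_map (algebraMap ℝ ℂ) ?_
    intro z hz
    have hz0 : aeval z p = 0 := by
      rw [mem_roots (hp.map _).ne_zero, IsRoot, eval_map_algebraMap] at hz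
      exact hz
    have h1 := h z
    rw [hz0, norm_zero] at h1
    have hdeg : p.natDegree ≠ 0 := by
      intro h0
      rw [hp.natDegree_eq_zero.mp h0] at hz0
      simp at hz0
    have h2 : |z.im| ^ p.natDegree = 0 := le_antisymm h1 (by positivity)
    have h3 : z.im = 0 := by simpa using eq_zero_of_pow_eq_zero h2
    exact ⟨z.re, by apply Complex.ext <;> simp [h3]⟩

variable {ι : Type*} [Fintype ι] [DecidableEq ι]

/-- Both polynomials have the same complex roots. The degree of the minimal polynomial jumps, while
the characteristic polynomial has constant degree and varies continuously with `M`. -/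
theorem charpoly_splits_iff_minpoly_splits (M : Matrix ι ι ℝ) :
    M.charpoly.Splits ↔ (minpoly ℝ M).Splits := by
  constructor
  · exact fun h => h.of_dvd M.charpoly_monic.ne_zero M.minpoly_dvd_charpoly
  · intro h
    have hs : (M.charpoly.map (algebraMap ℝ ℂ)).Splits := IsAlgClosed.splits _
    refine hs.of_splits_map (algebraMap ℝ ℂ) ?_
    intro z hz
    rw [mem_roots (M.charpoly_monic.map _).ne_zero, ← Matrix.charpoly_map,
      ← Matrix.charpoly_toLin', ← Module.End.hasEigenvalue_iff_isRoot_charpoly] at hz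
    obtain ⟨x, hx⟩ := hz.exists_hasEigenvector
    have h0 : aeval (Matrix.toLin' (M.map (algebraMap ℝ ℂ)))
        ((minpoly ℝ M).map (algebraMap ℝ ℂ)) = 0 := by
      have h1 := minpoly.aeval ℝ M
      have h2 : aeval ((Algebra.ofId ℝ ℂ).mapMatrix M) (minpoly ℝ M) = 0 := by
        rw [aeval_algHom_apply, h1, map_zero]
      have h3 : aeval (Matrix.toLinAlgEquiv' (M.map (algebraMap ℝ ℂ)))
        ((minpoly ℝ M).map (algebraMap ℝ ℂ)) = 0 := by
        rw [← AlgEquiv.coe_toAlgHom, aeval_algHom_apply, aeval_map_algebraMap]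
        have h4 : M.map (algebraMap ℝ ℂ) = (Algebra.ofId ℝ ℂ).mapMatrix M := rfl
        rw [h4, h2, map_zero]
      exact h3
    have h5 := Module.End.aeval_apply_of_hasEigenvector (p := (minpoly ℝ M).map (algebraMap ℝ ℂ)) hx
    rw [h0, LinearMap.zero_apply, eq_comm, smul_eq_zero, or_iff_left hx.2] at h5
    rw [eval_map_algebraMap] at h5
    have h6 := (splits_iff_im_pow_le (minpoly.monic (Matrix.isIntegral M))).mp h z
    rw [h5, norm_zero] at h6
    have h2 := le_antisymm h6 (by positivity)
    have h3 : z.im = 0 := by simpa using eq_zero_of_pow_eq_zero h2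
    exact ⟨z.re, by apply Complex.ext <;> simp [h3]⟩

variable {B : Type*} [NormedRing B] [NormedAlgebra ℝ B] [FiniteDimensional ℝ B]

/-- In a finite-dimensional normed algebra, having a split minimal polynomial is a closed
condition. -/
theorem isClosed_setOf_minpoly_splits : IsClosed {A : B | (minpoly ℝ A).Splits} := by
  classical
  let b := Module.finBasis ℝ B
  -- In the regular representation the exponent is `dim B` for every `A`, so each `z` gives a closed
  -- condition on `A`.
  have key : ∀ A : B, (minpoly ℝ A).Splits ↔
      ∀ z : ℂ, |z.im| ^ Fintype.card (Fin (Module.finrank ℝ B)) ≤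
        ‖(Matrix.scalar _ z - (Algebra.leftMulMatrix b A).map (algebraMap ℝ ℂ)).det‖ := by
    intro A
    rw [← minpoly.algHom_eq (Algebra.leftMulMatrix b) (Algebra.leftMulMatrix_injective b) A,
      ← charpoly_splits_iff_minpoly_splits, splits_iff_im_pow_le (Matrix.charpoly_monic _),
      Matrix.charpoly_natDegree_eq_dim]
    refine forall_congr' fun z => ?_
    rw [← eval_map_algebraMap, ← Matrix.charpoly_map, Matrix.eval_charpoly]
  simp only [key, Set.ofPred_forall]
  refine isClosed_iInter fun z => isClosed_le continuous_const (Continuous.norm ?_)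
  refine Continuous.matrix_det (continuous_const.sub ?_)
  refine Continuous.matrix_map ?_ Complex.continuous_ofReal
  exact (Algebra.leftMulMatrix b).toLinearMap.continuous_of_finiteDimensional

end SplitClosed

/-! ### A minimal idempotent and its corner. -/

section Idempotent

open Filter Topology

variable {B : Type*} [NormedRing B] [NormedAlgebra ℝ B]

/-- A closed real cone, closed under multiplication, that acts in a prime fashion and all of whose
elements have split real minimal polynomials. -/
structure IsSplitCone (T : Set B) : Prop where
  closed : IsClosed T
  mul_mem : ∀ {a b : B}, a ∈ T → b ∈ T → a * b ∈ T
  smul_mem : ∀ (r : ℝ) {a : B}, a ∈ T → r • a ∈ T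
  prime : ∀ {a b : B}, a ≠ 0 → b ≠ 0 → ∃ s ∈ T, a * s * b ≠ 0
  splits : ∀ {a : B}, a ∈ T → (minpoly ℝ a).Splits

variable {T : Set B}

theorem IsSplitCone.pow_mem (hT : IsSplitCone T) {a : B} (ha : a ∈ T) {m : ℕ} (hm : m ≠ 0) :
    a ^ m ∈ T := by
  induction m with
  | zero => exact absurd rfl hm
  | succ m ih =>
    rcases eq_or_ne m 0 with rfl | h
    · simpa using ha
    · rw [pow_succ]
      exact hT.mul_mem (ih h) ha

variable [FiniteDimensional ℝ B]

/-- A non-nilpotent element of minimal rank acts on its range with a scalar square. -/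
theorem IsSplitCone.sq_mul_eq_smul (hT : IsSplitCone T) {F : B} (hF : IsMinimalRank T F)
    (hnil : ∀ m : ℕ, F ^ m ≠ 0) : ∃ c : ℝ, 0 < c ∧ F ^ 2 * F = c • F := by
  set R := rightIdeal F with hRdef
  have hFR : ∀ x, F * x ∈ R := mul_mem_rightIdeal F
  have hRR : ∀ x ∈ R, F * x ∈ R := fun x _ => hFR x
  have hpowR : ∀ m : ℕ, m ≠ 0 → F ^ m ∈ R := by
    intro m hm
    obtain ⟨k, rfl⟩ := Nat.exists_eq_succ_of_ne_zero hm
    rw [Nat.succ_eq_add_one, pow_succ']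
    exact hFR _
  have hinjF : ∀ v ∈ R, F * v = 0 → v = 0 := by
    intro v hv h
    refine eq_zero_of_map_mulLeft_eq (L := F) (R := R) ?_ hv h
    rw [hRdef, rightIdeal_map_mulLeft]
    exact hF.rightIdeal_eq (hT.mul_mem hF.mem hF.mem) (by simpa [pow_two] using hnil 2) (hFR F)
  obtain ⟨s, hs⟩ : ∃ s : Multiset ℝ, minpoly ℝ F =
      (s.map fun a => Polynomial.X - Polynomial.C a).prod :=
    ⟨_, (hT.splits hF.mem).eq_prod_roots_of_monic (minpoly.monic (IsIntegral.of_finite ℝ F))⟩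
  have hann : ∀ v : B, Polynomial.aeval F
      (s.map fun a => Polynomial.X - Polynomial.C a).prod * v = 0 := by
    intro v
    rw [← hs, minpoly.aeval, zero_mul]
  obtain ⟨lam, v₀, hv₀R, hv₀, hev₀⟩ :=
    exists_eigenvector_of_prod F R hRR s (self_mem_rightIdeal F) hF.ne_zero (hann F)
  have hlam : lam ≠ 0 := by
    rintro rfl
    rw [zero_smul] at hev₀
    exact hv₀ (hinjF v₀ hv₀R hev₀)
  have hsq : ∀ (a : ℝ) (w : B), F * w = a • w → F ^ 2 * w = a ^ 2 • w := by
    intro a w h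
    rw [pow_two, mul_assoc, h, mul_smul_comm, h, smul_smul, pow_two]
  -- Passing to `F ^ 2` removes the signs: its real eigenvalues on `R` are squares, so the limit
  -- below can separate them only by size.
  set c := lam ^ 2 with hc
  have hc0 : 0 < c := by positivity
  -- a limit of the normalized powers
  have hGne : ∀ m : ℕ, ‖(F ^ 2) ^ m‖ ≠ 0 := by
    intro m
    rw [← pow_mul, norm_ne_zero_iff]
    exact hnil _
  have : ProperSpace B := FiniteDimensional.proper_real B
  -- The exponent `m + 1` avoids the zeroth power, since `1` need not lie in `T` or `R`.
  obtain ⟨L, hLs, φ, hφ, hL⟩ := (isCompact_sphere (0 : B) 1).tendsto_subseq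
    (x := fun m => ‖(F ^ 2) ^ (m + 1)‖⁻¹ • (F ^ 2) ^ (m + 1)) (by
      intro m
      rw [mem_sphere_zero_iff_norm, norm_smul, norm_inv, norm_norm, inv_mul_cancel₀ (hGne _)])
  have hL0 : L ≠ 0 := by
    rintro rfl
    simp at hLs
  have hmemT : ∀ m : ℕ, ‖(F ^ 2) ^ (m + 1)‖⁻¹ • (F ^ 2) ^ (m + 1) ∈ T := by
    intro m
    refine hT.smul_mem _ ?_
    rw [← pow_mul]
    exact hT.pow_mem hF.mem (by omega)
  have hmemR : ∀ m : ℕ, ‖(F ^ 2) ^ (m + 1)‖⁻¹ • (F ^ 2) ^ (m + 1) ∈ R := by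
    intro m
    refine R.smul_mem _ ?_
    rw [← pow_mul]
    exact hpowR _ (by omega)
  have hLT : L ∈ T := hT.closed.mem_of_tendsto hL (Eventually.of_forall fun k => hmemT _)
  have hLR : L ∈ R :=
    R.closed_of_finiteDimensional.mem_of_tendsto hL (Eventually.of_forall fun k => hmemR _)
  have hLRR : rightIdeal L = R := hF.rightIdeal_eq hLT hL0 hLR
  have hcomm : L * F = F * L := by
    refine tendsto_nhds_unique (hL.mul_const F) ((hL.const_mul F).congr fun k => ?_)
    simp only [Function.comp_apply, mul_smul_comm, smul_mul_assoc]
    rw [← pow_mul, ← pow_succ, ← pow_succ']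
  -- `L R = L F B = F L B = F R = R`, using that `L` generates the same right ideal as `F`.
  have hinjL : ∀ v ∈ R, v ≠ 0 → L * v ≠ 0 := by
    intro v hv h0 h
    refine h0 (eq_zero_of_map_mulLeft_eq (L := L) (R := R) ?_ hv h)
    rw [hRdef, rightIdeal_map_mulLeft, hcomm, ← rightIdeal_map_mulLeft, hLRR, hRdef,
      rightIdeal_map_mulLeft]
    exact hF.rightIdeal_eq (hT.mul_mem hF.mem hF.mem) (by simpa [pow_two] using hnil 2) (hFR F)
  -- renormalize by the powers of `c`
  set ψ : ℕ → ℕ := fun k => φ k + 1 with hψ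
  have hψm : StrictMono ψ := fun a b h => Nat.add_lt_add_right (hφ h) 1
  set t : ℕ → ℝ := fun k => ‖(F ^ 2) ^ ψ k‖⁻¹ * c ^ ψ k with ht
  have hev : ∀ (m : ℕ), (F ^ 2) ^ m * v₀ = c ^ m • v₀ := by
    intro m
    induction m with
    | zero => simp
    | succ m ih => rw [pow_succ', mul_assoc, ih, mul_smul_comm, hsq _ _ hev₀, smul_smul, ← pow_succ]
  have ht1 : Tendsto (fun k => t k • v₀) atTop (𝓝 (L * v₀)) := by
    refine (hL.mul_const v₀).congr fun k => ?_
    simp only [Function.comp_apply, smul_mul_assoc, ht, hψ]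
    rw [hev, smul_smul]
  -- Testing on `v₀` shows that the norms grow like `c ^ ψ k`, so normalizing by `c` still gives a
  -- nonzero multiple of `L`.
  have htl : Tendsto t atTop (𝓝 (‖L * v₀‖ / ‖v₀‖)) := by
    refine (ht1.norm.div_const ‖v₀‖).congr fun k => ?_
    have : 0 ≤ t k := by positivity
    rw [norm_smul, Real.norm_of_nonneg this, mul_div_assoc, div_self (norm_ne_zero_iff.mpr hv₀),
      mul_one]
  have hl0 : ‖L * v₀‖ / ‖v₀‖ ≠ 0 :=
    div_ne_zero (norm_ne_zero_iff.mpr (hinjL v₀ hv₀R hv₀)) (norm_ne_zero_iff.mpr hv₀)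
  have hH : Tendsto (fun k => (c⁻¹ • F ^ 2) ^ ψ k) atTop (𝓝 ((‖L * v₀‖ / ‖v₀‖)⁻¹ • L)) := by
    refine ((htl.inv₀ hl0).smul hL).congr fun k => ?_
    simp only [Function.comp_apply, ht, hψ]
    rw [smul_smul, smul_pow]
    congr 1
    have h1 := hGne (φ k + 1)
    rw [mul_inv, inv_inv, mul_right_comm, mul_inv_cancel₀ h1, one_mul, inv_pow]
  have heig : ∀ a : ℝ, ∀ w ∈ R, w ≠ 0 → F * w = a • w → a ^ 2 = c := by
    intro a w hw hw0 h
    have h1 : c⁻¹ * a ^ 2 = 1 := by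
      refine eigenvalue_eq_one_of_tendsto_pow hψm hH (v := w) (by positivity) ?_ ?_
      · rw [smul_mul_assoc, hsq _ _ h, smul_smul]
      · rw [smul_mul_assoc]
        exact smul_ne_zero (inv_ne_zero hl0) (hinjL w hw hw0)
    field_simp at h1
    exact h1
  have hss : ∀ v ∈ R, ∀ w ∈ R, F ^ 2 * v = c • v + w → F ^ 2 * w = c • w → w = 0 := by
    intro v _ w _ hv hw
    have h1 : c⁻¹ • w = 0 := by
      refine unipotent_fixed_of_tendsto_pow hψm hH (v := v) ?_ ?_
      · rw [smul_mul_assoc, hv, smul_add, inv_smul_smul₀ hc0.ne']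
      · rw [smul_mul_assoc, mul_smul_comm, hw, inv_smul_smul₀ hc0.ne']
    exact (smul_eq_zero.mp h1).resolve_left (inv_ne_zero hc0.ne')
  exact ⟨c, hc0, sq_mul_eq_smul_of_prod F R hRR c heig hss s (self_mem_rightIdeal F) (hann F)⟩

/-- A split cone contains a nonzero idempotent of minimal rank. -/
theorem IsSplitCone.exists_idempotent [Nontrivial B] (hT : IsSplitCone T) :
    ∃ E, IsMinimalRank T E ∧ E * E = E := by
  obtain ⟨s₀, hs₀, hs₀'⟩ := hT.prime (one_ne_zero (α := B)) (one_ne_zero (α := B))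
  obtain ⟨A, hA⟩ := exists_isMinimalRank (T := T) ⟨s₀, hs₀, by simpa using hs₀'⟩
  obtain ⟨C, hC, hACA⟩ := hT.prime hA.ne_zero hA.ne_zero
  have hACT : A * C ∈ T := hT.mul_mem hA.mem hC
  have hmem : A ∈ rightIdeal (A * C * A) := by
    rw [hA.rightIdeal_eq (hT.mul_mem hACT hA.mem) hACA
      (by rw [mul_assoc]; exact mul_mem_rightIdeal _ _)]
    exact self_mem_rightIdeal A
  obtain ⟨X, hX⟩ := mem_rightIdeal.mp hmem
  -- Iterating `A = A C A X` shows that `A C` is not nilpotent.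
  have hpow : ∀ m : ℕ, (A * C) ^ m * A * X ^ m = A := by
    intro m
    induction m with
    | zero => simp
    | succ m ih =>
      calc (A * C) ^ (m + 1) * A * X ^ (m + 1) = (A * C) ^ m * (A * C * A * X) * X ^ m := by
            rw [pow_succ, pow_succ']; simp only [mul_assoc]
        _ = A := by rw [hX, ih]
  have hnil : ∀ m : ℕ, (A * C) ^ m ≠ 0 := by
    intro m h
    apply hA.ne_zero
    rw [← hpow m, h, zero_mul, zero_mul]
  have hF : IsMinimalRank T (A * C) :=
    hA.of_mem hACT (by simpa using hnil 1) (mul_mem_rightIdeal _ _)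
  obtain ⟨c, hc, h⟩ := hT.sq_mul_eq_smul hF hnil
  set F := A * C
  have h4 : F ^ 2 * F ^ 2 = c • F ^ 2 := by
    rw [pow_two F, ← mul_assoc, ← pow_two, h, smul_mul_assoc, ← pow_two]
  refine ⟨c⁻¹ • F ^ 2, hF.of_mem (hT.smul_mem _ (hT.pow_mem hF.mem two_ne_zero))
    (smul_ne_zero (inv_ne_zero hc.ne') (hnil 2)) ?_, ?_⟩
  · rw [pow_two]
    exact (rightIdeal F).smul_mem _ (mul_mem_rightIdeal _ _)
  · rw [smul_mul_smul_comm, h4, smul_smul, mul_assoc, inv_mul_cancel₀ hc.ne', mul_one]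

/-- In the corner of a minimal idempotent every nonzero element of the cone has a positive scalar
square. -/
theorem IsSplitCone.corner_sq (hT : IsSplitCone T) {E : B} (hE : IsMinimalRank T E)
    {g : B} (hg : g ∈ T) (hEg : E * g = g) (hgE : g * E = g) (hg0 : g ≠ 0) :
    ∃ c : ℝ, 0 < c ∧ g * g = c • E := by
  have hgmem : g ∈ rightIdeal E := mem_rightIdeal.mpr ⟨g, hEg⟩
  have hgR : rightIdeal g = rightIdeal E := hE.rightIdeal_eq hg hg0 hgmem
  obtain ⟨X, hX⟩ := mem_rightIdeal.mp (show E ∈ rightIdeal g by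
    rw [hgR]; exact self_mem_rightIdeal E)
  have hpow : ∀ m : ℕ, g ^ m * E * (E * X) ^ m = E := by
    intro m
    induction m with
    | zero => simp
    | succ m ih =>
      calc g ^ (m + 1) * E * (E * X) ^ (m + 1)
          = g ^ m * (g * E * E * X) * (E * X) ^ m := by
            rw [pow_succ, pow_succ']; simp only [mul_assoc]
        _ = E := by rw [hgE, hgE, hX, ih]
  have hnil : ∀ m : ℕ, g ^ m ≠ 0 := by
    intro m h
    apply hE.ne_zero
    rw [← hpow m, h, zero_mul, zero_mul]
  obtain ⟨c, hc, h⟩ := hT.sq_mul_eq_smul (hE.of_mem hg hg0 hgmem) hnil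
  refine ⟨c, hc, ?_⟩
  calc g * g = g ^ 2 * g * X := by rw [mul_assoc, hX, pow_two, mul_assoc, hgE]
    _ = c • E := by rw [h, smul_mul_assoc, hX]

/-- The corner of a minimal idempotent is one-dimensional. -/
theorem IsSplitCone.corner_eq_smul (hT : IsSplitCone T) {E : B} (hE : IsMinimalRank T E)
    (hEE : E * E = E) {A : B} (hA : A ∈ T) : ∃ r : ℝ, E * A * E = r • E := by
  have hmem : ∀ {a : B}, a ∈ T → E * a * E ∈ T := fun h =>
    hT.mul_mem (hT.mul_mem hE.mem h) hE.mem
  have hl : ∀ a : B, E * (E * a * E) = E * a * E := fun a => by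
    rw [← mul_assoc, ← mul_assoc, hEE]
  have hr : ∀ a : B, E * a * E * E = E * a * E := fun a => by rw [mul_assoc _ E E, hEE]
  have hcomm : ∀ {g h : B}, g ∈ T → h ∈ T → E * g = g → g * E = g → E * h = h → h * E = h →
      g * h = h * g := by
    intro g h hg hh hEg hgE hEh hhE
    rcases eq_or_ne g 0 with rfl | hg0
    · simp
    rcases eq_or_ne h 0 with rfl | hh0
    · simp
    obtain ⟨a, ha, hga⟩ := hT.corner_sq hE hg hEg hgE hg0
    obtain ⟨b, hb, hhb⟩ := hT.corner_sq hE hh hEh hhE hh0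
    have hgh0 : g * h ≠ 0 := by
      intro h0
      have : g * (g * h) = a • h := by rw [← mul_assoc, hga, smul_mul_assoc, hEh]
      rw [h0, mul_zero, eq_comm, smul_eq_zero] at this
      exact this.elim ha.ne' hh0
    obtain ⟨c, hc, hghc⟩ := hT.corner_sq hE (hT.mul_mem hg hh)
      (by rw [← mul_assoc, hEg]) (by rw [mul_assoc, hhE]) hgh0
    have h1 : (a * b) • (h * g) = c • (g * h) := by
      have : g * (g * h * (g * h)) * h = (a * b) • (h * g) := by
        calc g * (g * h * (g * h)) * h = (g * g) * (h * g) * (h * h) := by simp only [mul_assoc]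
          _ = (a * b) • (h * g) := by
            rw [hga, hhb, smul_mul_assoc, mul_smul_comm, smul_mul_assoc, smul_smul, ← mul_assoc,
              hEh, mul_assoc, hgE, mul_comm a b]
      rw [← this, hghc, mul_smul_comm, smul_mul_assoc, hgE]
    -- Conjugating twice by `h`, whose square is scalar, gives `u ^ 2 = 1`. Positivity of `u` then
    -- excludes anticommuting elements, as in the quaternions.
    have h2 : h * g = (c / (a * b)) • (g * h) := by
      rw [div_eq_inv_mul, ← smul_smul, ← h1, inv_smul_smul₀ (by positivity)]
    set u := c / (a * b) with hu
    have hupos : 0 < u := by positivity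
    have h3 : b • g = (u * u * b) • g := by
      calc b • g = h * (h * g) := by rw [← mul_assoc, hhb, smul_mul_assoc, hEg]
        _ = (u * u) • (g * (h * h)) := by
          rw [h2, mul_smul_comm, ← mul_assoc, h2, smul_mul_assoc, smul_smul, mul_assoc]
        _ = (u * u * b) • g := by rw [hhb, mul_smul_comm, hgE, smul_smul]
    have h4 : b = u * u * b := smul_left_injective ℝ hg0 h3
    have h5 : u = 1 := by
      have : u * u = 1 := by
        apply mul_right_cancel₀ hb.ne'
        rw [← h4, one_mul]
      nlinarith
    rw [h2, h5, one_smul]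
  set g := E * A * E with hgdef
  rcases eq_or_ne g 0 with h0 | h0
  · exact ⟨0, by rw [h0, zero_smul]⟩
  obtain ⟨c, hc, hcg⟩ := hT.corner_sq hE (hmem hA) (hl A) (hr A) h0
  set d := Real.sqrt c
  have hdd : d * d = c := Real.mul_self_sqrt hc.le
  by_contra hne
  have hm : g - d • E ≠ 0 := fun h => hne ⟨d, sub_eq_zero.mp h⟩
  have hp : g + d • E ≠ 0 := fun h => hne ⟨-d, by rw [neg_smul]; exact eq_neg_of_add_eq_zero_left h⟩
  -- Inside the corner `s` acts as `E s E`, which commutes with `g`, so the product contains the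
  -- factor `g ^ 2 - d ^ 2 E = 0`.
  obtain ⟨s, hs, hs0⟩ := hT.prime hm hp
  apply hs0
  have hgE : g * E = g := hr A
  have hEg : E * g = g := hl A
  have hc1 : g * (E * s * E) = (E * s * E) * g :=
    hcomm (hmem hA) (hmem hs) hEg hgE (hl s) (hr s)
  have e1 : (g - d • E) * s * (g + d • E) = (g - d • E) * (E * s * E) * (g + d • E) := by
    have a1 : (g - d • E) * E = g - d • E := by rw [sub_mul, smul_mul_assoc, hgE, hEE]
    have a2 : E * (g + d • E) = g + d • E := by rw [mul_add, mul_smul_comm, hEg, hEE]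
    calc (g - d • E) * s * (g + d • E) = ((g - d • E) * E) * s * (E * (g + d • E)) := by
          rw [a1, a2]
      _ = _ := by simp only [mul_assoc]
  have e2 : (g - d • E) * (E * s * E) = (E * s * E) * (g - d • E) := by
    rw [sub_mul, mul_sub, hc1, smul_mul_assoc, mul_smul_comm, hl, hr]
  have e3 : (g - d • E) * (g + d • E) = 0 := by
    rw [sub_mul, mul_add, mul_add, hcg, mul_smul_comm, smul_mul_assoc, smul_mul_smul_comm, hgE, hEg,
      hEE, hdd]
    abel
  rw [e1, e2, mul_assoc, e3, mul_zero]

/-- A multiplicatively closed set acting in a prime fashion, such that all multiples of its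
elements have split minimal polynomials, spans an algebra with a rank-one idempotent. -/
theorem exists_idempotent_mem_span [Nontrivial B] (S : Subsemigroup B)
    (hprime : ∀ {a b : B}, a ≠ 0 → b ≠ 0 → ∃ s ∈ S, a * s * b ≠ 0)
    (hsplit : ∀ a ∈ S, ∀ r : ℝ, (minpoly ℝ (r • a)).Splits) :
    ∃ E ∈ Submodule.span ℝ (S : Set B), E ≠ 0 ∧ E * E = E ∧
      ∀ A ∈ Submodule.span ℝ (S : Set B), ∃ r : ℝ, E * A * E = r • E := by
  set T₀ : Set B := {x | ∃ r : ℝ, ∃ a ∈ S, r • a = x} with hT₀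
  have hST : (S : Set B) ⊆ closure T₀ := fun a ha => subset_closure ⟨1, a, ha, one_smul _ _⟩
  have hT : IsSplitCone (closure T₀) := by
    refine ⟨isClosed_closure, ?_, ?_, ?_, ?_⟩
    · intro a b ha hb
      refine map_mem_closure₂ continuous_mul ha hb ?_
      rintro _ ⟨r, a, ha, rfl⟩ _ ⟨r', a', ha', rfl⟩
      exact ⟨r * r', a * a', S.mul_mem ha ha', (smul_mul_smul_comm _ _ _ _).symm⟩
    · intro r a ha
      refine map_mem_closure (continuous_const_smul r) ha ?_
      rintro _ ⟨r', a, ha, rfl⟩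
      exact ⟨r * r', a, ha, (smul_smul _ _ _).symm⟩
    · intro a b ha hb
      obtain ⟨s, hs, h⟩ := hprime ha hb
      exact ⟨s, hST hs, h⟩
    · intro a ha
      refine closure_minimal (t := {A : B | (minpoly ℝ A).Splits}) ?_
        isClosed_setOf_minpoly_splits ha
      rintro _ ⟨r, a, ha, rfl⟩
      exact hsplit a ha r
  have hspan : closure T₀ ⊆ (Submodule.span ℝ (S : Set B) : Set B) := by
    refine closure_minimal ?_ (Submodule.closed_of_finiteDimensional _)
    rintro _ ⟨r, a, ha, rfl⟩
    exact Submodule.smul_mem _ _ (Submodule.subset_span ha)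
  obtain ⟨E, hE, hEE⟩ := hT.exists_idempotent
  refine ⟨E, hspan hE.mem, hE.ne_zero, hEE, fun A hA => ?_⟩
  induction hA using Submodule.span_induction with
  | mem x hx => exact hT.corner_eq_smul hE hEE (hST hx)
  | zero => exact ⟨0, by simp⟩
  | add x y _ _ hx hy =>
    obtain ⟨r, hr⟩ := hx
    obtain ⟨t, ht⟩ := hy
    exact ⟨r + t, by rw [mul_add, add_mul, hr, ht, add_smul]⟩
  | smul a x _ hx =>
    obtain ⟨r, hr⟩ := hx
    exact ⟨a * r, by rw [mul_smul_comm, smul_mul_assoc, hr, smul_smul]⟩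

end Idempotent

/-! ### Right spectra and real minimal polynomials. -/

namespace QuatMatrix

open Polynomial

variable {n : ℕ}

/-- Right multiplication of a column by a quaternion. -/
noncomputable def rsmul (x : Fin n → ℍ[ℝ]) (c : ℍ[ℝ]) : Fin n → ℍ[ℝ] := fun i => x i * c

theorem mulVec_rsmul (A : Mat n) (x : Fin n → ℍ[ℝ]) (c : ℍ[ℝ]) :
    A *ᵥ rsmul x c = rsmul (A *ᵥ x) c := by
  ext1 i
  simp only [rsmul, Matrix.mulVec, dotProduct, Finset.sum_mul, mul_assoc]

theorem aeval_mulVec_of_eigenvector {A : Mat n} {x : Fin n → ℍ[ℝ]} {c : ℍ[ℝ]}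
    (h : A *ᵥ x = rsmul x c) (p : ℝ[X]) : (aeval A p) *ᵥ x = rsmul x (aeval c p) := by
  induction p using Polynomial.induction_on' with
  | add p q hp hq =>
    rw [map_add, map_add, Matrix.add_mulVec, hp, hq]
    ext1 i
    simp [rsmul, mul_add]
  | monomial m a =>
    have hpow : ∀ m : ℕ, (A ^ m) *ᵥ x = rsmul x (c ^ m) := by
      intro m
      induction m with
      | zero => ext1 i; simp [rsmul]
      | succ m ih =>
        rw [pow_succ', ← Matrix.mulVec_mulVec, ih, mulVec_rsmul, h]
        ext1 i
        simp only [rsmul, mul_assoc, pow_succ']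
    rw [aeval_monomial, aeval_monomial, ← Algebra.smul_def, ← Algebra.smul_def,
      Matrix.smul_mulVec, hpow]
    ext1 i
    simp only [rsmul, Pi.smul_apply, mul_smul_comm]

/-- Real coefficients are central, so a right eigenvalue is a root of the minimal polynomial; as `ℍ`
has no zero divisors, one linear factor vanishes there. -/
theorem hasRealSpectrum_of_splits {A : Mat n} (h : (minpoly ℝ A).Splits) : HasRealSpectrum A := by
  rintro c ⟨x, hx, hxc⟩
  obtain ⟨i, hi⟩ := Function.ne_iff.mp hx
  have h1 := aeval_mulVec_of_eigenvector hxc (minpoly ℝ A)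
  rw [minpoly.aeval, Matrix.zero_mulVec] at h1
  have h2 : aeval c (minpoly ℝ A) = 0 := by
    have := congrFun h1 i
    exact (mul_eq_zero.mp this.symm).resolve_left hi
  rw [h.eq_prod_roots_of_monic (minpoly.monic (IsIntegral.of_finite ℝ A))] at h2
  generalize (minpoly ℝ A).roots = s at h2
  induction s using Multiset.induction_on with
  | empty => simp at h2
  | cons a s ih =>
    rw [Multiset.map_cons, Multiset.prod_cons, map_mul, mul_eq_zero] at h2
    rcases h2 with h2 | h2
    · refine ⟨a, ?_⟩
      rw [map_sub, aeval_X, aeval_C, sub_eq_zero] at h2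
      exact h2.symm
    · exact ih h2

/-- A complex structure on a nonzero vector gives an eigenvector with eigenvalue `±i`. -/
theorem exists_eigenvector_of_sq_neg {N : Mat n} {x : Fin n → ℍ[ℝ]} (hx : x ≠ 0)
    (hN : N *ᵥ (N *ᵥ x) = -x) :
    ∃ y : Fin n → ℍ[ℝ], y ≠ 0 ∧ ∃ e : ℍ[ℝ], e * e = -1 ∧ N *ᵥ y = rsmul y e := by
  let I : ℍ[ℝ] := ⟨0, 1, 0, 0⟩
  have hI : I * I = -1 := by
    ext
    · rw [Quaternion.re_mul]; simp [I]
    · rw [Quaternion.imI_mul]; simp [I]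
    · rw [Quaternion.imJ_mul]; simp [I]
    · rw [Quaternion.imK_mul]; simp [I]
  by_cases h : N *ᵥ x = rsmul x (-I)
  · exact ⟨x, hx, -I, by rw [neg_mul_neg, hI], h⟩
  -- `N (N x + x I) = -x + (N x) I = (N x + x I) I`.
  · refine ⟨N *ᵥ x + rsmul x I, fun h0 => h ?_, I, hI, ?_⟩
    · rw [eq_neg_of_add_eq_zero_left h0]
      ext1 i
      simp [rsmul]
    · rw [Matrix.mulVec_add, hN, mulVec_rsmul]
      ext1 i
      simp only [rsmul, Pi.add_apply, Pi.neg_apply, add_mul, mul_assoc, hI]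
      simp [add_comm]

/-- A nonreal root `z` gives a real quadratic factor that kills some nonzero column. On it `N = (A -
re z) / im z` squares to `-1`, which yields a right eigenvalue `re z + (im z) e` with `e ^ 2 = -1`.
-/
theorem splits_of_hasRealSpectrum {A : Mat n} (h : HasRealSpectrum A) : (minpoly ℝ A).Splits := by
  have hmon : (minpoly ℝ A).Monic := minpoly.monic (IsIntegral.of_finite ℝ A)
  have hs : ((minpoly ℝ A).map (algebraMap ℝ ℂ)).Splits := IsAlgClosed.splits _
  refine hs.of_splits_map (algebraMap ℝ ℂ) ?_
  intro z hz
  rw [mem_roots (hmon.map _).ne_zero, IsRoot, eval_map_algebraMap] at hz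
  by_cases him : z.im = 0
  · exact ⟨z.re, by apply Complex.ext <;> simp [him]⟩
  exfalso
  obtain ⟨q, hq⟩ := Polynomial.quadratic_dvd_of_aeval_eq_zero_im_ne_zero _ hz him
  set d : ℝ[X] := X ^ 2 - C (2 * z.re) * X + C (‖z‖ ^ 2) with hd
  have hdm : d.natDegree = 2 := by rw [hd]; compute_degree!
  have hq0 : q ≠ 0 := by
    rintro rfl
    rw [mul_zero] at hq
    exact hmon.ne_zero hq
  have hd0 : d ≠ 0 := by rintro h0; rw [h0] at hdm; simp at hdm
  have hqA : aeval A q ≠ 0 := by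
    intro h0
    have h1 := Polynomial.natDegree_le_of_dvd (minpoly.dvd ℝ A h0) hq0
    rw [hq, natDegree_mul hd0 hq0, hdm] at h1
    omega
  have hdq : aeval A d * aeval A q = 0 := by rw [← map_mul, ← hq, minpoly.aeval]
  obtain ⟨j, hj⟩ : ∃ j, (aeval A q).col j ≠ 0 := by
    by_contra! hall
    apply hqA
    ext1 i j
    exact congrFun (hall j) i
  set x := (aeval A q).col j with hx
  have hdx : aeval A d *ᵥ x = 0 := by
    ext1 i
    exact congrFun (congrFun hdq i) j
  set N : Mat n := z.im⁻¹ • (A - z.re • (1 : Mat n)) with hN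
  have hA : A = z.re • (1 : Mat n) + z.im • N := by
    rw [hN, smul_inv_smul₀ him]; abel
  have hdN : aeval A d = (z.im ^ 2) • (N * N + 1) := by
    have h1 : aeval A d = A * A - (2 * z.re) • A + (‖z‖ ^ 2) • (1 : Mat n) := by
      rw [hd, map_add, map_sub, map_mul, map_pow, aeval_X, aeval_C, aeval_C, ← Algebra.smul_def,
        Algebra.algebraMap_eq_smul_one, pow_two]
    rw [h1, Complex.sq_norm, Complex.normSq_apply]
    conv_lhs => rw [hA]
    simp only [add_mul, mul_add, smul_mul_assoc, mul_smul_comm, one_mul, mul_one]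
    module
  have hNx : N *ᵥ (N *ᵥ x) = -x := by
    rw [hdN, Matrix.smul_mulVec, smul_eq_zero, or_iff_right (pow_ne_zero 2 him),
      Matrix.add_mulVec, Matrix.one_mulVec, ← Matrix.mulVec_mulVec] at hdx
    exact eq_neg_of_add_eq_zero_left hdx
  obtain ⟨y, hy, e, he, hNy⟩ := exists_eigenvector_of_sq_neg hj hNx
  obtain ⟨r, hr⟩ := h (show (z.re : ℍ[ℝ]) + z.im • e ∈ rightSpectrum A from ⟨y, hy, by
    conv_lhs => rw [hA]
    rw [Matrix.add_mulVec, Matrix.smul_mulVec, Matrix.smul_mulVec, hNy, Matrix.one_mulVec]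
    ext1 i
    simp only [rsmul, Pi.add_apply, Pi.smul_apply, mul_add, mul_smul_comm,
      Quaternion.mul_coe_eq_smul]⟩)
  have he' : e = ((z.im⁻¹ * (r - z.re) : ℝ) : ℍ[ℝ]) := by
    have h1 : z.im • e = ((r - z.re : ℝ) : ℍ[ℝ]) := by
      simp only at hr
      rw [Quaternion.coe_sub, hr, add_sub_cancel_left]
    rw [Quaternion.coe_mul, ← h1, Quaternion.coe_mul_eq_smul, inv_smul_smul₀ him]
  rw [he', ← Quaternion.coe_mul] at he
  have h1 : z.im⁻¹ * (r - z.re) * (z.im⁻¹ * (r - z.re)) = -1 := by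
    have := congrArg QuaternionAlgebra.re he
    rwa [Quaternion.re_coe] at this
  nlinarith [mul_self_nonneg (z.im⁻¹ * (r - z.re))]

theorem hasRealSpectrum_iff_minpoly_splits (A : Mat n) :
    HasRealSpectrum A ↔ (minpoly ℝ A).Splits :=
  ⟨splits_of_hasRealSpectrum, hasRealSpectrum_of_splits⟩

theorem HasRealSpectrum.smul {A : Mat n} (h : HasRealSpectrum A) (r : ℝ) :
    HasRealSpectrum (r • A) := by
  rintro c ⟨x, hx, hxc⟩
  rw [Matrix.smul_mulVec] at hxc
  rcases eq_or_ne r 0 with rfl | hr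
  · obtain ⟨i, hi⟩ := Function.ne_iff.mp hx
    have := congrFun hxc i
    rw [zero_smul, Pi.zero_apply, eq_comm, mul_eq_zero] at this
    exact ⟨0, by simpa using (this.resolve_left hi).symm⟩
  · obtain ⟨t, ht⟩ := h (show r⁻¹ • c ∈ rightSpectrum A from ⟨x, hx, by
      rw [← inv_smul_smul₀ hr (A *ᵥ x), hxc]
      ext1 i
      simp only [Pi.smul_apply, mul_smul_comm]⟩)
    refine ⟨r * t, ?_⟩
    simp only at ht ⊢
    rw [Quaternion.coe_mul, ht, Quaternion.coe_mul_eq_smul, smul_inv_smul₀ hr]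

/-! ### Consequences of irreducibility. -/

/-- Irreducibility makes the semigroup act in a prime fashion. -/
theorem IsIrreducible.exists_mul_mul_ne_zero {S : Subsemigroup (Mat n)}
    (hS : IsIrreducible (S : Set (Mat n))) {a : Mat n} (ha : a ≠ 0) {x : Fin n → ℍ[ℝ]}
    (hx : x ≠ 0) : ∃ s ∈ S, a *ᵥ (s *ᵥ x) ≠ 0 := by
  by_contra! hall
  apply ha
  have hmem : ∀ y : Fin n → ℍ[ℝ], a *ᵥ y = 0 := by
    intro y
    have hy : y ∈ Submodule.span ℍ[ℝ]ᵐᵒᵖ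
        {y | ∃ A ∈ Subsemigroup.closure (S : Set (Mat n)), A *ᵥ x = y} := by
      rw [hS x hx]; trivial
    induction hy using Submodule.span_induction with
    | mem y hy =>
      obtain ⟨A, hA, rfl⟩ := hy
      rw [Subsemigroup.closure_eq] at hA
      exact hall A hA
    | zero => exact Matrix.mulVec_zero a
    | add y z _ _ hy hz => rw [Matrix.mulVec_add, hy, hz, add_zero]
    | smul c y _ hy => rw [Matrix.mulVec_smul, hy, smul_zero]
  ext1 i j
  have := congrFun (hmem (Pi.single j 1)) i
  rwa [Matrix.mulVec_single_one] at this

theorem exists_rank_one_idempotent [NeZero n] {S : Subsemigroup (Mat n)}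
    (hS : IsIrreducible (S : Set (Mat n))) (hspec : ∀ A ∈ S, HasRealSpectrum A) :
    ∃ E ∈ Submodule.span ℝ (S : Set (Mat n)), E ≠ 0 ∧ E * E = E ∧
      ∀ A ∈ Submodule.span ℝ (S : Set (Mat n)), ∃ r : ℝ, E * A * E = r • E := by
  let : NormedRing (Mat n) := Matrix.linftyOpNormedRing
  let : NormedAlgebra ℝ (Mat n) := Matrix.linftyOpNormedAlgebra
  refine exists_idempotent_mem_span S ?_ fun a ha r =>
    splits_of_hasRealSpectrum ((hspec a ha).smul r)
  intro a b ha hb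
  obtain ⟨j, hj⟩ : ∃ j, b.col j ≠ 0 := by
    by_contra! hall
    apply hb
    ext1 i j
    exact congrFun (hall j) i
  obtain ⟨s, hs, h⟩ := hS.exists_mul_mul_ne_zero ha hj
  refine ⟨s, hs, fun h0 => h ?_⟩
  rw [Matrix.mulVec_mulVec]
  ext1 i
  exact congrFun (congrFun h0 i) j

/-! ### The real form. -/

/-- The standard basis of the right vector space of columns. -/
noncomputable def columnBasis (n : ℕ) : Module.Basis (Fin n) ℍ[ℝ]ᵐᵒᵖ (Fin n → ℍ[ℝ]) :=
  Module.Basis.ofEquivFun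
    (LinearEquiv.piCongrRight fun _ => MulOpposite.opLinearEquiv ℍ[ℝ]ᵐᵒᵖ)

/-- A spanning set of columns contains the columns of an invertible matrix. -/
theorem exists_unit_col_mem {U : Set (Fin n → ℍ[ℝ])} (hU : Submodule.span ℍ[ℝ]ᵐᵒᵖ U = ⊤) :
    ∃ Q : (Mat n)ˣ, ∀ j, Q.val.col j ∈ U := by
  obtain ⟨s, hsU, hspan, hli⟩ := exists_linearIndependent ℍ[ℝ]ᵐᵒᵖ U
  let b := Module.Basis.mk hli (by rw [Subtype.range_coe, hspan, hU])
  let v := b.reindex (b.indexEquiv (columnBasis n))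
  have hv : ∀ j, v j ∈ U := fun j => by
    simp only [v, b, Module.Basis.reindex_apply, Module.Basis.mk_apply]
    exact hsU (Subtype.coe_prop _)
  let Q : Mat n := Matrix.of fun i j => v j i
  have hQ : ∀ x : Fin n → ℍ[ℝ], Q *ᵥ x = ∑ j, MulOpposite.op (x j) • v j := by
    intro x
    ext1 i
    simp [Q, Matrix.mulVec, dotProduct]
  have hinj : ∀ x : Fin n → ℍ[ℝ], Q *ᵥ x = 0 → x = 0 := by
    intro x hx
    rw [hQ] at hx
    ext1 j
    exact MulOpposite.op_injective (Fintype.linearIndependent_iff.mp v.linearIndependent _ hx j)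
  let R : Mat n := Matrix.of fun i j => (v.repr (Pi.single j 1) i).unop
  have hQR : Q * R = 1 := by
    ext1 i j
    have h1 : Q *ᵥ R.col j = Pi.single j 1 := by
      rw [hQ]
      exact v.sum_repr _
    have h2 := congrFun h1 i
    rw [Matrix.one_apply, ← Pi.single_apply]
    exact h2
  have hRQ : R * Q = 1 := by
    have h0 : Q * (R * Q - 1) = 0 := by
      rw [mul_sub, ← mul_assoc, hQR, one_mul, mul_one, sub_self]
    rw [← sub_eq_zero]
    ext1 i j
    refine congrFun (hinj ((R * Q - 1).col j) ?_) i
    ext1 k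
    exact congrFun (congrFun h0 k) j
  exact ⟨⟨Q, R, hQR, hRQ⟩, hv⟩

theorem sum_smul_coe (r a : Fin n → ℝ) :
    ∑ k, r k • ((a k : ℝ) : ℍ[ℝ]) = ((∑ k, a k * r k : ℝ) : ℍ[ℝ]) := by
  rw [← Quaternion.algebraMap_def, map_sum]
  refine Finset.sum_congr rfl fun k _ => ?_
  rw [mul_comm, map_mul, Algebra.smul_def]

theorem mem_realAlg_iff {S : Subsemigroup (Mat n)} {A : Mat n} :
    A ∈ realAlg (S : Set (Mat n)) ↔ A ∈ Submodule.span ℝ (S : Set (Mat n)) := by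
  rw [← realAlg_eq_span]
  rfl

/-- An irreducible semigroup with real spectra spans a copy of the real matrix algebra. -/
theorem similar_of_isIrreducible [NeZero n] {S : Subsemigroup (Mat n)}
    (hS : IsIrreducible (S : Set (Mat n))) (hspec : ∀ A ∈ S, HasRealSpectrum A) :
    Similar (realAlg (S : Set (Mat n)) : Set (Mat n)) (realMatrices n) := by
  obtain ⟨E, hE, hE0, hEE, hcorner⟩ := exists_rank_one_idempotent hS hspec
  simp only [← mem_realAlg_iff] at hE hcorner
  set 𝒜 := realAlg (S : Set (Mat n))
  have hSA : ∀ A ∈ S, A ∈ 𝒜 := fun A hA => mem_realAlg_iff.mpr (Submodule.subset_span hA)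
  obtain ⟨j₀, hj₀⟩ : ∃ j, E.col j ≠ 0 := by
    by_contra! hall
    apply hE0
    ext1 i j
    exact congrFun (hall j) i
  set u := E.col j₀ with hu
  have hEu : E *ᵥ u = u := by
    ext1 i
    exact congrFun (congrFun hEE i) j₀
  obtain ⟨i₀, hi₀⟩ := Function.ne_iff.mp hj₀
  have hspan : Submodule.span ℍ[ℝ]ᵐᵒᵖ {y | ∃ A ∈ 𝒜, A *ᵥ u = y} = ⊤ := by
    refine eq_top_iff.mpr ((hS u hj₀).ge.trans (Submodule.span_mono ?_))
    rintro _ ⟨A, hA, rfl⟩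
    rw [Subsemigroup.closure_eq] at hA
    exact ⟨A, hSA A hA, rfl⟩
  obtain ⟨Q, hQ⟩ := exists_unit_col_mem hspan
  choose C hC hCu using hQ
  -- `E A Q` has real coordinates along `u`
  have hreal : ∀ A ∈ 𝒜, ∃ r : Fin n → ℝ, ∀ i j, (E * A * Q.val) i j = r j • u i := by
    intro A hA
    have h1 : ∀ j, ∃ r : ℝ, ∀ i, (E * A * Q.val) i j = r • u i := by
      intro j
      -- Column `j` of `E A Q` is `E A C_j u = (E A C_j E) u`, because `E u = u`.
      obtain ⟨r, hr⟩ := hcorner (A * C j) (𝒜.mul_mem hA (hC j))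
      refine ⟨r, fun i => ?_⟩
      have h2 : (E * A) *ᵥ Q.val.col j = r • u := by
        rw [← hCu j, Matrix.mulVec_mulVec]
        conv_lhs => rw [← hEu]
        rw [Matrix.mulVec_mulVec, mul_assoc E A, hr, Matrix.smul_mulVec, hEu]
      exact congrFun h2 i
    choose r hr using h1
    exact ⟨r, fun i j => hr j i⟩
  have hann : ∀ x : Fin n → ℍ[ℝ], (∀ A ∈ 𝒜, (E * A * Q.val) *ᵥ x = 0) → x = 0 := by
    intro x hx
    have h1 : Q.val *ᵥ x = 0 := by
      by_contra hne
      obtain ⟨s, hs, h⟩ := hS.exists_mul_mul_ne_zero hE0 hne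
      apply h
      rw [Matrix.mulVec_mulVec, Matrix.mulVec_mulVec]
      exact hx s (hSA s hs)
    calc x = (Q⁻¹).val *ᵥ (Q.val *ᵥ x) := by simp
      _ = 0 := by rw [h1, Matrix.mulVec_zero]
  have hmulVec : ∀ (A : Mat n) (r : Fin n → ℝ), (∀ i j, (E * A * Q.val) i j = r j • u i) →
      ∀ (x : Fin n → ℍ[ℝ]) i, ((E * A * Q.val) *ᵥ x) i = u i * ∑ k, r k • x k := by
    intro A r hr x i
    simp only [Matrix.mulVec, dotProduct, hr, Finset.mul_sum, smul_mul_assoc, mul_smul_comm]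
  refine ⟨Q⁻¹, Set.Subset.antisymm ?_ ?_⟩
  · intro A hA
    set Z : Mat n := (Q⁻¹).val * A * Q.val with hZ
    have hQZ : Q.val * Z = A * Q.val := by simp [hZ, ← mul_assoc]
    refine ⟨Z, ⟨Z.map fun q => q.re, ?_⟩, ?_⟩
    · ext1 i j
      -- Each real row `r` pairs with column `j` of `Z` to a real number, hence annihilates the
      -- imaginary part of that column; `hann` finishes.
      have key : (fun k => Z k j - ((Z k j).re : ℍ[ℝ])) = 0 := by
        refine hann _ fun A' hA' => ?_
        obtain ⟨r, hr⟩ := hreal A' hA'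
        obtain ⟨t, ht⟩ := hreal (A' * A) (𝒜.mul_mem hA' hA)
        have hsum : ∑ k, r k • Z k j = (t j : ℍ[ℝ]) := by
          have h1 : (E * A' * Q.val) * Z = E * (A' * A) * Q.val := by
            rw [mul_assoc, hQZ]; simp only [mul_assoc]
          have h2 := hmulVec A' r hr (Z.col j) i₀
          have h3 : ((E * A' * Q.val) *ᵥ Z.col j) i₀ = t j • u i₀ := by
            rw [← ht, ← h1]; rfl
          rw [h3, ← Quaternion.mul_coe_eq_smul] at h2
          exact (mul_left_cancel₀ hi₀ h2).symm
        have hre : ∑ k, (Z k j).re * r k = t j := by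
          let ρ : ℍ[ℝ] →ₗ[ℝ] ℝ :=
            { toFun := fun q => q.re
              map_add' := fun _ _ => rfl
              map_smul' := fun _ _ => rfl }
          have h4 := congrArg ρ hsum
          rw [map_sum] at h4
          simp only [map_smul, smul_eq_mul, mul_comm (r _)] at h4
          exact h4
        ext1 i
        rw [hmulVec A' r hr, Pi.zero_apply]
        simp only [smul_sub, Finset.sum_sub_distrib, hsum]
        rw [sum_smul_coe, hre, sub_self, mul_zero]
      have := congrFun key i
      rw [Pi.zero_apply, sub_eq_zero] at this
      exact this.symm
    · simp [hZ, mul_assoc]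
  · rintro _ ⟨_, ⟨B, rfl⟩, rfl⟩
    let W : Submodule ℝ (Fin n → ℝ) :=
      { carrier := {r | ∃ A ∈ 𝒜, ∀ i j, (E * A * Q.val) i j = r j • u i}
        zero_mem' := ⟨0, 𝒜.zero_mem, by simp⟩
        add_mem' := by
          rintro r t ⟨A, hA, hr⟩ ⟨A', hA', ht⟩
          refine ⟨A + A', 𝒜.add_mem hA hA', fun i j => ?_⟩
          rw [mul_add, add_mul, Matrix.add_apply, hr, ht, Pi.add_apply, add_smul]
        smul_mem' := by
          rintro a r ⟨A, hA, hr⟩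
          refine ⟨a • A, 𝒜.toSubmodule.smul_mem a hA, fun i j => ?_⟩
          rw [mul_smul_comm, smul_mul_assoc, Matrix.smul_apply, hr, Pi.smul_apply, smul_smul,
            smul_eq_mul] }
    have hW : W = ⊤ := by
      -- A nonzero functional vanishing on `W` would supply a nonzero real column killed by every `E
      -- A Q`.
      by_contra hne
      obtain ⟨f, hf0, hf⟩ := Submodule.exists_le_ker_of_lt_top W (lt_top_iff_ne_top.mpr hne)
      apply hf0
      have hx : (fun k => ((f (Pi.single k 1) : ℝ) : ℍ[ℝ])) = 0 := by
        refine hann _ fun A hA => ?_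
        obtain ⟨r, hr⟩ := hreal A hA
        have h1 : f r = 0 := hf (show r ∈ W from ⟨A, hA, hr⟩)
        rw [LinearMap.pi_apply_eq_sum_univ f r] at h1
        ext1 i
        rw [hmulVec A r hr, Pi.zero_apply, sum_smul_coe]
        have h2 : ∑ k, f (Pi.single k 1) * r k = 0 := by
          rw [← h1]
          refine Finset.sum_congr rfl fun k _ => ?_
          rw [smul_eq_mul, mul_comm]
          congr 2
          ext1 l
          simp [Pi.single_apply, eq_comm]
        rw [h2]
        simp
      refine LinearMap.pi_ext' fun k => LinearMap.ext_ring ?_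
      have := congrFun hx k
      rw [Pi.zero_apply, ← Quaternion.coe_zero] at this
      exact Quaternion.coe_injective this
    have hrow : ∀ j, ∃ A ∈ 𝒜, ∀ i k,
        (E * A * Q.val) i k = (Pi.single j 1 : Fin n → ℝ) k • u i := fun j =>
      show (Pi.single j 1 : Fin n → ℝ) ∈ W by rw [hW]; trivial
    choose D hD hDr using hrow
    -- Both sides have `C_i u`, column `i` of `Q`, in position `j` and zeros elsewhere.
    have hsingle : ∀ i j, Q.val * Matrix.single i j (1 : ℍ[ℝ]) = C i * (E * D j * Q.val) := by
      intro i j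
      ext1 l k
      have h1 : (C i *ᵥ u) l = Q.val l i := congrFun (hCu i) l
      rw [Matrix.mul_apply (M := C i)]
      simp only [hDr, mul_smul_comm]
      rw [← Finset.smul_sum]
      have h2 : ∑ m, C i l m * u m = Q.val l i := h1
      rw [h2, Matrix.mul_apply, Finset.sum_eq_single i]
      · rcases eq_or_ne j k with rfl | h
        · simp
        · simp [h, h.symm]
      · intro m _ hm
        simp [hm.symm]
      · simp
    have hunit : ∀ i j, Q.val * Matrix.single i j (1 : ℍ[ℝ]) * (Q⁻¹).val ∈ 𝒜 := by
      intro i j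
      rw [hsingle]
      have : C i * (E * D j * Q.val) * (Q⁻¹).val = C i * (E * D j) := by simp [mul_assoc]
      rw [this]
      exact 𝒜.mul_mem (hC i) (𝒜.mul_mem hE (hD j))
    have hB : B.map (fun r : ℝ => (r : ℍ[ℝ])) =
        ∑ i, ∑ j, B i j • Matrix.single i j (1 : ℍ[ℝ]) := by
      rw [Matrix.matrix_eq_sum_single (B.map _)]
      refine Finset.sum_congr rfl fun i _ => Finset.sum_congr rfl fun j _ => ?_
      rw [Matrix.smul_single, Matrix.map_apply]
      congr 1
      rw [← Quaternion.coe_mul_eq_smul, mul_one]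
    rw [inv_inv]
    change Q.val * B.map (fun r : ℝ => (r : ℍ[ℝ])) * (Q⁻¹).val ∈ 𝒜
    rw [hB, Finset.mul_sum, Finset.sum_mul]
    refine sum_mem fun i _ => ?_
    rw [Finset.mul_sum, Finset.sum_mul]
    refine sum_mem fun j _ => ?_
    rw [mul_smul_comm, smul_mul_assoc]
    exact 𝒜.toSubmodule.smul_mem _ (hunit i j)

end QuatMatrix

theorem theorem2p5 (n : ℕ) :
    (∀ A : QuatMatrix.Mat n,
      QuatMatrix.HasRealSpectrum A ↔ (minpoly ℝ A).Splits) ∧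
    ∀ S : Subsemigroup (QuatMatrix.Mat n),
      QuatMatrix.IsIrreducible (S : Set (QuatMatrix.Mat n)) →
      (∀ A ∈ S, QuatMatrix.HasRealSpectrum A) →
      QuatMatrix.Similar (QuatMatrix.realAlg (S : Set (QuatMatrix.Mat n)) : Set (QuatMatrix.Mat n))
        (QuatMatrix.realMatrices n) := by
  refine ⟨QuatMatrix.hasRealSpectrum_iff_minpoly_splits, fun S hS hspec => ?_⟩
  rcases Nat.eq_zero_or_pos n with rfl | hn
  · refine ⟨1, Set.ext fun A => ⟨fun _ => ?_, fun _ => ?_⟩⟩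
    · exact ⟨0, ⟨0, Subsingleton.elim _ _⟩, Subsingleton.elim _ _⟩
    · rw [Subsingleton.elim A 0]
      exact zero_mem _
  · have : NeZero n := ⟨hn.ne'⟩
    exact QuatMatrix.similar_of_isIrreducible hS hspec
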